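/- Let $P$ be a simple polygon in the plane with edge set $E$, and let $\delta\colon E\to\mathbb{R}_{\ge 0}$. In the additively-weighted wavefront propagation of $(P,\delta)$ the wavefront at time $0$ is $P$. At time $t\ge 0$ the wavefront fragments emanated by an edge $e$ lie on the line $\overline{e}+\max(0,t-\delta(e))\,n_e$, where $\overline{e}$ is the supporting line of $e$ and $n_e$ is its inward unit normal; thus $e$ is stationary until time $\delta(e)$ and then moves inwards at unit speed. Fragments that are adjacent on the wavefront stay adjacent, and the wavefront is kept planar by events: in an edge event a fragment that has shrunk to length zero is removed, and its two neighbours become adjacent; in a split event a vertex of a wavefront polygon reaches another fragment of it, and the polygon is split there into two. Wavefront polygons that have collapsed are removed, and the process ends when none is left. (If two consecutive collinear fragments, exactly one of which is moving, become adjacent or start to have different speeds, then one of them, either one, takes over the other at once.) Let $e(t)$ be the set of wavefront fragments of $e$ at time $t$ (at the time of an event, those just before and those just after it), and let $f(e)=\bigcup_{t\ge 0}e(t)$ be the face of $e$ in the additively-weighted straight skeleton, where $e(t)$ is identified with the union of its fragments. Then the following hold. 1. For every $P$, every $\delta$, every additively-weighted wavefront propagation of $(P,\delta)$ and every edge $e$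 of $P$, the face $f(e)$ is connected. 2. There are $P$, $\delta$, a propagation and an edge $e$ such that the interior of $f(e)$ is empty. 3. There are $P$, $\delta$, a propagation and an edge $e$ such that the interior of $f(e)$ is nonempty and disconnected. 4. There are $P$, $\delta$, a propagation and an edge $e$ such that the interior of $f(e)$ is nonempty and not adjacent to $e$: its closure is disjoint from $e$. -/

import Mathlib

open scoped NNReal

noncomputable section

namespace StraightSkeleton

/-- The Euclidean plane. -/
abbrev Plane : Type := EuclideanSpace ℝ (Fin 2)

/-- The determinant of two plane vectors. -/
def cross (u v : Plane) : ℝ := u 0 * v 1 - u 1 * v 0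

/-- A simple polygon with `n` vertices, listed counterclockwise, so that the interior lies to the
left of every edge. Edge `i` runs from vertex `i` to the cyclically next vertex. Interior angles of
180 degrees are permitted. -/
structure SimplePolygon (n : ℕ) extends Polygon Plane n where
  three_le : 3 ≤ n
  nondegenerate : toPolygon.HasNondegenerateEdges
  /-- Two different edges meet at most in a vertex that they share as neighbours. -/
  edges_inter : ∀ i j : Fin n, i ≠ j →
    ∀ x ∈ toPolygon.edgeSet ℝ i, x ∈ toPolygon.edgeSet ℝ j →
      (j = finRotate n i ∧ x = vertices j) ∨ (i = finRotate n j ∧ x = vertices i)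
  /-- The signed area is positive. -/
  counterclockwise : 0 < ∑ i : Fin n, cross (vertices i) (vertices (finRotate n i))

namespace SimplePolygon

variable {n : ℕ}

/-- The unit vector in the direction of edge `e`. -/
def direction (P : SimplePolygon n) (e : Fin n) : Plane :=
  ‖P.vertices (finRotate n e) - P.vertices e‖⁻¹ • (P.vertices (finRotate n e) - P.vertices e)

/-- The inward facing unit normal of edge `e`: its direction turned left by 90 degrees. -/
def inwardNormal (P : SimplePolygon n) (e : Fin n) : Plane :=
  !₂[-(P.direction e 1), P.direction e 0]

/-- The line that carries the wavefront fragments of `e` at time `t`: the supporting line of `e`,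
displaced by `max 0 (t - δ e)` times the inward unit normal. -/
def supportingLine (P : SimplePolygon n) (δ : Fin n → ℝ≥0) (e : Fin n) (t : ℝ) : Set Plane :=
  {x | ∃ s : ℝ, x = P.vertices e + s • P.direction e + max 0 (t - δ e) • P.inwardNormal e}

end SimplePolygon

/-- A wavefront polygon at one instant, as the cyclic list of its fragments: each entry holds the
edge of the input polygon that emanated the fragment, and the start point of the fragment. The end
point of a fragment is the start point of the cyclically next entry. -/
abbrev WavefrontPolygon (n : ℕ) : Type := List (Fin n × Plane)

/-- A wavefront polygon whose vertices move: start points are functions of time. -/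
abbrev KineticPolygon (n : ℕ) : Type := List (Fin n × (ℝ → Plane))

/-- The wavefront polygon at time `t`. -/
def KineticPolygon.at {n : ℕ} (L : KineticPolygon n) (t : ℝ) : WavefrontPolygon n :=
  L.map fun a => (a.1, a.2 t)

/-- The vertices of a kinetic polygon, as triples
(edge of the incoming fragment, edge of the outgoing fragment, trajectory). -/
def KineticPolygon.corners {n : ℕ} (L : KineticPolygon n) : List (Fin n × Fin n × (ℝ → Plane)) :=
  List.zipWith (fun a b => (a.1, b.1, b.2)) L (L.rotate 1)

/-- The fragments of a wavefront polygon, as triples (edge, start point, end point). -/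
def fragments {n : ℕ} (L : WavefrontPolygon n) : List (Fin n × Plane × Plane) :=
  List.zipWith (fun a b => (a.1, a.2, b.2)) L (L.rotate 1)

/-- All fragments at time `t` of a wavefront that consists of several polygons. -/
def fragmentsAt {n : ℕ} (W : List (KineticPolygon n)) (t : ℝ) : List (Fin n × Plane × Plane) :=
  W.flatMap fun L => fragments (L.at t)

/-- Two fragments meet at most in a point that is the end of one and the start of the other. If this
holds for any two of a family of cyclic lists of nondegenerate fragments, then these lists are
simple polygons with at least three edges, and no two of these polygons touch. -/
def NonCrossing {n : ℕ} (f g : Fin n × Plane × Plane) : Prop :=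
  ∀ x ∈ segment ℝ f.2.1 f.2.2, x ∈ segment ℝ g.2.1 g.2.2 →
    (x = f.2.2 ∧ x = g.2.1) ∨ (x = f.2.1 ∧ x = g.2.2)

/-- The wavefront `W` keeps its combinatorial structure and moves as prescribed during `[s, t]`.
For `s = t` this only places the vertices on the supporting lines. -/
structure IsMotion {n : ℕ} (P : SimplePolygon n) (δ : Fin n → ℝ≥0) (s t : ℝ)
    (W : List (KineticPolygon n)) : Prop where
  /-- Vertices do not jump. -/
  continuous : ∀ L ∈ W, ∀ c ∈ L.corners, ContinuousOn c.2.2 (Set.Icc s t)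
  /-- Incidences are preserved: a vertex stays on the moving supporting lines of the two edges
  whose fragments it joins. -/
  incident : ∀ L ∈ W, ∀ c ∈ L.corners, ∀ τ ∈ Set.Icc s t,
    c.2.2 τ ∈ P.supportingLine δ c.1 τ ∧ c.2.2 τ ∈ P.supportingLine δ c.2.1 τ
  /-- A vertex between two parallel fragments moves along the bisector of its straight angle. -/
  bisector : ∀ L ∈ W, ∀ c ∈ L.corners, cross (P.direction c.1) (P.direction c.2.1) = 0 →
    ∀ τ ∈ Set.Icc s t, inner ℝ (P.direction c.1) (c.2.2 τ - c.2.2 s) = 0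
  /-- Before the next event, every fragment has positive length and the orientation of its edge. -/
  oriented : ∀ τ ∈ Set.Ico s t, ∀ f ∈ fragmentsAt W τ,
    ∃ l : ℝ, 0 < l ∧ f.2.2 - f.2.1 = l • P.direction f.1
  /-- Between events the wavefront is planar. -/
  planar : ∀ τ ∈ Set.Ioo s t, (fragmentsAt W τ).Pairwise NonCrossing

/-- The elementary changes at time `t` of a single wavefront polygon, which is replaced by a list of
polygons. Simultaneous and more complex events are sequences of these. -/
inductive PolygonEvent {n : ℕ} (P : SimplePolygon n) (δ : Fin n → ℝ≥0) (t : ℝ) :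
    WavefrontPolygon n → List (WavefrontPolygon n) → Prop
  /-- Edge event: a fragment of length zero is removed, its neighbours become adjacent. -/
  | edge (e f : Fin n) (p : Plane) (R : WavefrontPolygon n) :
      PolygonEvent P δ t ((e, p) :: (f, p) :: R) [(f, p) :: R]
  /-- Split event: the vertex `v` lies on another fragment, that of edge `c` from `p` to `q`. The
  polygon is split there into two polygons, each of which receives a part of this fragment. -/
  | split (b c g : Fin n) (v p q : Plane) (X R : WavefrontPolygon n) (hv : v ∈ segment ℝ p q) :
      PolygonEvent P δ t ((b, v) :: X ++ (c, p) :: (g, q) :: R)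
        [(b, v) :: X ++ [(c, p)], (c, v) :: (g, q) :: R]
  /-- A polygon with at most two fragments has collapsed and is removed. (With two fragments, these
  are parallel edges, or parts of them, that have moved into each other.) -/
  | collapse (L : WavefrontPolygon n) (hL : L.length ≤ 2) : PolygonEvent P δ t L []
  /-- Two consecutive collinear fragments of which exactly one is moving have no common vertex
  motion. Then one of them takes over the other at once: here the first one, ... -/
  | takeoverLeft (a b c : Fin n) (p q r : Plane) (R : WavefrontPolygon n)
      (hdir : P.direction a = P.direction b)
      (hspeed : ¬ ((δ a : ℝ) ≤ t ↔ (δ b : ℝ) ≤ t)) (hpq : p ≠ q) (hqr : q ≠ r) :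
      PolygonEvent P δ t ((a, p) :: (b, q) :: (c, r) :: R) [(a, p) :: (c, r) :: R]
  /-- ... and here the second one. Either choice is admitted. -/
  | takeoverRight (a b c : Fin n) (p q r : Plane) (R : WavefrontPolygon n)
      (hdir : P.direction a = P.direction b)
      (hspeed : ¬ ((δ a : ℝ) ≤ t ↔ (δ b : ℝ) ≤ t)) (hpq : p ≠ q) (hqr : q ≠ r) :
      PolygonEvent P δ t ((a, p) :: (b, q) :: (c, r) :: R) [(b, p) :: (c, r) :: R]

/-- The elementary events of a wavefront at time `t`. -/
inductive WavefrontEvent {n : ℕ} (P : SimplePolygon n) (δ : Fin n → ℝ≥0) (t : ℝ) :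
    List (WavefrontPolygon n) → List (WavefrontPolygon n) → Prop
  /-- One polygon `L` of the wavefront, read from a suitable starting fragment, changes. -/
  | polygon (A B : List (WavefrontPolygon n)) (L L' : WavefrontPolygon n)
      (M : List (WavefrontPolygon n)) (hrot : L.IsRotated L') (h : PolygonEvent P δ t L' M) :
      WavefrontEvent P δ t (A ++ L :: B) (A ++ M ++ B)
  /-- Speed-change event: the edge `e` starts to move. The combinatorial structure is unchanged. -/
  | speedChange (e : Fin n) (he : (δ e : ℝ) = t) (C : List (WavefrontPolygon n)) :
      WavefrontEvent P δ t C C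

/-- An additively-weighted wavefront propagation of `P` with additive weights `δ`, from the polygon
`P` at time zero until all wavefront polygons have collapsed. It passes through finitely many
stages; stage `k` lasts from `time k` to `time (k + 1)` and ends with an elementary event. Events
that happen at the same time are separated by stages of duration zero. -/
structure Propagation {n : ℕ} (P : SimplePolygon n) (δ : Fin n → ℝ≥0) where
  numStages : ℕ
  time : ℕ → ℝ
  wavefront : ℕ → List (KineticPolygon n)
  time_zero : time 0 = 0
  time_le : ∀ k < numStages, time k ≤ time (k + 1)
  initial : (wavefront 0).map (fun L => L.at (time 0)) = [List.ofFn fun i => (i, P.vertices i)]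
  motion : ∀ k < numStages, IsMotion P δ (time k) (time (k + 1)) (wavefront k)
  event : ∀ k < numStages, WavefrontEvent P δ (time (k + 1))
    ((wavefront k).map fun L => L.at (time (k + 1)))
    ((wavefront (k + 1)).map fun L => L.at (time (k + 1)))
  final : wavefront numStages = []

namespace Propagation

variable {n : ℕ} {P : SimplePolygon n} {δ : Fin n → ℝ≥0}

/-- `e(t)`, the set of the wavefront fragments of edge `e` at time `t`. At the time of an event it
holds the fragments just before and those just after the event. -/
def edgeFragments (W : Propagation P δ) (e : Fin n) (t : ℝ) : Set (Set Plane) :=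
  {S | ∃ k < W.numStages, t ∈ Set.Icc (W.time k) (W.time (k + 1)) ∧
    ∃ f ∈ fragmentsAt (W.wavefront k) t, f.1 = e ∧ S = segment ℝ f.2.1 f.2.2}

/-- The face `f(e)`: the union of `e(t)` over all `t ≥ 0`. -/
def face (W : Propagation P δ) (e : Fin n) : Set Plane :=
  ⋃ t : ℝ, ⋃ _ : 0 ≤ t, ⋃₀ W.edgeFragments e t

end Propagation

end StraightSkeleton

end

/-!
Every face is connected because its parts are traced back to its edge. During a stage, a fragment
moves continuously and sweeps a connected set. An elementary event creates no new place: every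
fragment after it touches a fragment of the same edge before it, since the pieces of a split
fragment, the neighbours of a removed fragment and the winner of a takeover all do. By induction on
the stages, every swept set lies in the connected component of the start vertex of its edge.

For the remaining claims a single pentagon suffices. Its roof would start to move only after the
wavefront has vanished, so its face has empty interior. Its floor starts to move at time `20`, when
the vertex between the fragments of a wall and the ceiling has just arrived there: the two halves of
the split fragment shrink on both sides of the line `x = 20` as they rise. Its ceiling also starts
to move at time `20`, but its fragment is carried sideways by the two moving walls and has by then
slid off the ceiling.
-/

noncomputable section

namespace StraightSkeleton

variable {n : ℕ}

theorem isLinearMap_cross (u : Plane) : IsLinearMap ℝ (cross u) where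
  map_add x y := by
    simp only [cross, PiLp.add_apply]
    ring
  map_smul c x := by
    simp only [cross, PiLp.smul_apply, smul_eq_mul]
    ring

@[fun_prop]
theorem continuous_cross (u : Plane) : Continuous (cross u) := by
  unfold cross
  fun_prop

theorem cross_le_of_mem_segment {u p q x : Plane} {c : ℝ} (hp : cross u p ≤ c)
    (hq : cross u q ≤ c) (hx : x ∈ segment ℝ p q) : cross u x ≤ c :=
  (convex_halfSpace_le (isLinearMap_cross u) c).segment_subset hp hq hx

theorem lt_cross_of_mem_segment {u p q x : Plane} {c : ℝ} (hp : c < cross u p)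
    (hq : c < cross u q) (hx : x ∈ segment ℝ p q) : c < cross u x :=
  (convex_halfSpace_gt (isLinearMap_cross u) c).segment_subset hp hq hx

theorem exists_pos_add_smul_mem_of_mem_interior {E : Type*} [AddCommGroup E] [Module ℝ E]
    [TopologicalSpace E] [ContinuousAdd E] [ContinuousSMul ℝ E] {S : Set E} {x : E}
    (hx : x ∈ interior S) (v : E) : ∃ ε : ℝ, 0 < ε ∧ x + ε • v ∈ S := by
  have hline : Filter.Tendsto (fun ε : ℝ => x + ε • v) (nhdsWithin 0 (Set.Ioi 0)) (nhds x) := by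
    have : Continuous fun ε : ℝ => x + ε • v := by fun_prop
    simpa using (this.tendsto 0).mono_left nhdsWithin_le_nhds
  obtain ⟨ε, hmem, hε⟩ := ((hline.eventually (mem_interior_iff_mem_nhds.1 hx)).and
    self_mem_nhdsWithin).exists
  exact ⟨ε, hε, hmem⟩

section Fragments

/-- The fragments of an open chain of a wavefront polygon, which ends at the point `z`. Cutting a
wavefront polygon into chains is what makes its split events computable. -/
def chainFragments : WavefrontPolygon n → Plane → List (Fin n × Plane × Plane)
  | [], _ => []
  | [a], z => [(a.1, a.2, z)]
  | a :: b :: R, z => (a.1, a.2, b.2) :: chainFragments (b :: R) z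

theorem chainFragments_cons_eq_zipWith (a : Fin n × Plane) (R : WavefrontPolygon n)
    (z : Fin n × Plane) :
    chainFragments (a :: R) z.2 =
      List.zipWith (fun a b => (a.1, a.2, b.2)) (a :: R) (R ++ [z]) := by
  induction R generalizing a with
  | nil => rfl
  | cons b R ih => simp [chainFragments, ih]

theorem chainFragments_append_cons (A : WavefrontPolygon n) (b : Fin n × Plane)
    (B : WavefrontPolygon n) (z : Plane) :
    chainFragments (A ++ b :: B) z = chainFragments A b.2 ++ chainFragments (b :: B) z := by
  induction A with
  | nil => rfl
  | cons a A ih =>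
    cases A with
    | nil => rfl
    | cons c A => simpa [chainFragments] using ih

theorem fragments_cons (a : Fin n × Plane) (R : WavefrontPolygon n) :
    fragments (a :: R) = chainFragments (a :: R) a.2 := by
  simp [chainFragments_cons_eq_zipWith, fragments]

theorem fragments_cons_append_cons (a b : Fin n × Plane) (A B : WavefrontPolygon n) :
    fragments (a :: A ++ b :: B) = chainFragments (a :: A) b.2 ++ chainFragments (b :: B) a.2 := by
  rw [List.cons_append, fragments_cons, ← List.cons_append, chainFragments_append_cons]

theorem fragments_rotate (L : WavefrontPolygon n) (k : ℕ) :
    fragments (L.rotate k) = (fragments L).rotate k := by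
  unfold fragments
  rw [List.zipWith_rotate_distrib _ _ _ _ (by simp), List.rotate_rotate, List.rotate_rotate,
    Nat.add_comm]

theorem mem_fragments_iff_of_isRotated {L L' : WavefrontPolygon n} (h : L.IsRotated L')
    {f : Fin n × Plane × Plane} : f ∈ fragments L' ↔ f ∈ fragments L := by
  obtain ⟨k, rfl⟩ := h
  rw [fragments_rotate, List.mem_rotate]

theorem coe_finRotate (i : Fin n) : (finRotate n i : ℕ) = (i + 1) % n := by
  obtain ⟨m, rfl⟩ := Nat.exists_eq_succ_of_ne_zero i.pos.ne'
  rw [finRotate_apply, Fin.val_add, Fin.val_one', Nat.add_mod_mod]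

theorem fragments_ofFn (p : Fin n → Plane) :
    fragments (List.ofFn fun i => (i, p i)) = List.ofFn fun i => (i, p i, p (finRotate n i)) := by
  refine List.ext_getElem (by simp [fragments]) fun i hi _ => ?_
  have hin : i < n := by simpa [fragments] using hi
  have hnext : finRotate n ⟨i, hin⟩ = ⟨(i + 1) % n, Nat.mod_lt _ (by omega)⟩ :=
    Fin.ext (coe_finRotate _)
  rw [List.getElem_ofFn, hnext]
  simp [fragments, List.getElem_rotate]

end Fragments

section Events

/-- `f` and `g` are fragments of the same edge that have a common point: the relation by which the
fragments after an event are tied to those before it. -/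
def Touches (f g : Fin n × Plane × Plane) : Prop :=
  f.1 = g.1 ∧ (segment ℝ f.2.1 f.2.2 ∩ segment ℝ g.2.1 g.2.2).Nonempty

theorem Touches.refl (f : Fin n × Plane × Plane) : Touches f f :=
  ⟨rfl, f.2.1, left_mem_segment _ _ _, left_mem_segment _ _ _⟩

theorem touches_of_start_eq (e : Fin n) (p q r : Plane) : Touches (e, p, q) (e, p, r) :=
  ⟨rfl, p, left_mem_segment _ _ _, left_mem_segment _ _ _⟩

theorem touches_of_end_eq (e : Fin n) (p q r : Plane) : Touches (e, p, r) (e, q, r) :=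
  ⟨rfl, r, right_mem_segment _ _ _, right_mem_segment _ _ _⟩

variable {P : SimplePolygon n} {δ : Fin n → ℝ≥0} {t : ℝ} {f : Fin n × Plane × Plane}

theorem PolygonEvent.exists_touches {L : WavefrontPolygon n} {M : List (WavefrontPolygon n)}
    (h : PolygonEvent P δ t L M) (hf : f ∈ M.flatMap fragments) :
    ∃ g ∈ fragments L, Touches f g := by
  cases h with
  | edge e g p R =>
    refine ⟨f, ?_, .refl f⟩
    simp only [List.flatMap_singleton, fragments_cons] at hf
    simp [fragments_cons, chainFragments, hf]
  | split b c g v p q X R hv =>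
    have hright : fragments ((c, v) :: (g, q) :: R) =
        (c, v, q) :: chainFragments ((g, q) :: R) v := fragments_cons _ _
    simp only [List.flatMap_cons, List.flatMap_nil, List.append_nil, hright,
      fragments_cons_append_cons, chainFragments, List.mem_append, List.mem_cons,
      List.not_mem_nil, or_false] at hf ⊢
    rcases hf with (hf | rfl) | rfl | hf
    · exact ⟨f, .inl hf, .refl f⟩
    · exact ⟨(c, p, q), .inr (.inl rfl), touches_of_start_eq c p v q⟩
    · exact ⟨(c, p, q), .inr (.inl rfl), touches_of_end_eq c v p q⟩
    · exact ⟨f, .inr (.inr hf), .refl f⟩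
  | collapse L hL => simp at hf
  | takeoverLeft a b c p q r R =>
    simp only [List.flatMap_singleton, fragments_cons, chainFragments, List.mem_cons] at hf ⊢
    rcases hf with rfl | hf
    · exact ⟨(a, p, q), .inl rfl, touches_of_start_eq a p r q⟩
    · exact ⟨f, .inr (.inr hf), .refl f⟩
  | takeoverRight a b c p q r R =>
    simp only [List.flatMap_singleton, fragments_cons, chainFragments, List.mem_cons] at hf ⊢
    rcases hf with rfl | hf
    · exact ⟨(b, q, r), .inr (.inl rfl), touches_of_end_eq b p q r⟩
    · exact ⟨f, .inr (.inr hf), .refl f⟩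

theorem WavefrontEvent.exists_touches {C D : List (WavefrontPolygon n)}
    (h : WavefrontEvent P δ t C D) (hf : f ∈ D.flatMap fragments) :
    ∃ g ∈ C.flatMap fragments, Touches f g := by
  cases h with
  | polygon A B L L' M hrot h =>
    simp only [List.flatMap_append, List.flatMap_cons, List.mem_append] at hf ⊢
    rcases hf with (hf | hf) | hf
    · exact ⟨f, .inl hf, .refl f⟩
    · obtain ⟨g, hg, hfg⟩ := h.exists_touches hf
      exact ⟨g, .inr (.inl ((mem_fragments_iff_of_isRotated hrot).1 hg)), hfg⟩
    · exact ⟨f, .inr (.inr hf), .refl f⟩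
  | speedChange e he C => exact ⟨f, hf, .refl f⟩

end Events

section Motion

/-- A moving fragment, as a triple (edge, trajectory of the start point, trajectory of the end
point). -/
abbrev KineticFragment (n : ℕ) : Type := Fin n × (ℝ → Plane) × (ℝ → Plane)

/-- The moving fragments of a wavefront, which are the fragments of `fragmentsAt` at each time. -/
def kineticFragments (W : List (KineticPolygon n)) : List (KineticFragment n) :=
  W.flatMap fun L => List.zipWith (fun a b => (a.1, a.2, b.2)) L (L.rotate 1)

theorem fragmentsAt_eq_map_kineticFragments (W : List (KineticPolygon n)) (t : ℝ) :
    fragmentsAt W t = (kineticFragments W).map fun φ => (φ.1, φ.2.1 t, φ.2.2 t) := by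
  simp only [fragmentsAt, kineticFragments, fragments, KineticPolygon.at, List.map_flatMap,
    List.map_zipWith, ← List.map_rotate, List.zipWith_map]

theorem mem_fragmentsAt_of_mem_kineticFragments {W : List (KineticPolygon n)}
    {φ : KineticFragment n} (hφ : φ ∈ kineticFragments W) (t : ℝ) :
    (φ.1, φ.2.1 t, φ.2.2 t) ∈ fragmentsAt W t := by
  rw [fragmentsAt_eq_map_kineticFragments]
  exact List.mem_map_of_mem hφ

theorem fragmentsAt_eq_flatMap_fragments (W : List (KineticPolygon n)) (t : ℝ) :
    fragmentsAt W t = (W.map fun L => L.at t).flatMap fragments := by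
  simp only [fragmentsAt, List.flatMap_map]

theorem exists_corner_outgoing_eq {L : KineticPolygon n} {a : Fin n × (ℝ → Plane)} (ha : a ∈ L) :
    ∃ c ∈ L.corners, c.2 = a := by
  obtain ⟨i, hi, rfl⟩ := List.getElem_of_mem (List.mem_rotate.2 ha : a ∈ L.rotate 1)
  have hiL : i < L.length := by simpa using hi
  refine ⟨(L[i].1, (L.rotate 1)[i]), List.mem_iff_getElem.2 ⟨i, ?_, ?_⟩, rfl⟩
  · simpa [KineticPolygon.corners] using hiL
  · simp [KineticPolygon.corners]

theorem exists_start_corner {W : List (KineticPolygon n)}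
    {φ : KineticFragment n} (hφ : φ ∈ kineticFragments W) :
    ∃ L ∈ W, ∃ c ∈ L.corners, c.2.1 = φ.1 ∧ c.2.2 = φ.2.1 := by
  obtain ⟨L, hL, hφ⟩ := List.mem_flatMap.1 hφ
  obtain ⟨i, hi, rfl⟩ := List.getElem_of_mem hφ
  have hiL : i < L.length := by simpa using hi
  obtain ⟨c, hc, hcL⟩ := exists_corner_outgoing_eq (List.getElem_mem hiL)
  exact ⟨L, hL, c, hc, by simp [hcL], by simp [hcL]⟩

theorem exists_end_corner {W : List (KineticPolygon n)}
    {φ : KineticFragment n} (hφ : φ ∈ kineticFragments W) :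
    ∃ L ∈ W, ∃ c ∈ L.corners, c.1 = φ.1 ∧ c.2.2 = φ.2.2 := by
  obtain ⟨L, hL, hφ⟩ := List.mem_flatMap.1 hφ
  obtain ⟨i, hi, rfl⟩ := List.getElem_of_mem hφ
  have hi' : i < (KineticPolygon.corners L).length := by simpa [KineticPolygon.corners] using hi
  exact ⟨L, hL, (KineticPolygon.corners L)[i], List.getElem_mem _,
    by simp [KineticPolygon.corners], by simp [KineticPolygon.corners]⟩

namespace IsMotion

variable {P : SimplePolygon n} {δ : Fin n → ℝ≥0} {s t : ℝ} {W : List (KineticPolygon n)}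
  {φ : KineticFragment n}

theorem continuousOn_start (h : IsMotion P δ s t W) (hφ : φ ∈ kineticFragments W) :
    ContinuousOn φ.2.1 (Set.Icc s t) := by
  obtain ⟨L, hL, c, hc, -, hcφ⟩ := exists_start_corner hφ
  exact hcφ ▸ h.continuous L hL c hc

theorem continuousOn_end (h : IsMotion P δ s t W) (hφ : φ ∈ kineticFragments W) :
    ContinuousOn φ.2.2 (Set.Icc s t) := by
  obtain ⟨L, hL, c, hc, -, hcφ⟩ := exists_end_corner hφ
  exact hcφ ▸ h.continuous L hL c hc

theorem start_mem_supportingLine (h : IsMotion P δ s t W) (hφ : φ ∈ kineticFragments W) {τ : ℝ}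
    (hτ : τ ∈ Set.Icc s t) : φ.2.1 τ ∈ P.supportingLine δ φ.1 τ := by
  obtain ⟨L, hL, c, hc, hce, hcφ⟩ := exists_start_corner hφ
  exact hce ▸ hcφ ▸ (h.incident L hL c hc τ hτ).2

theorem end_mem_supportingLine (h : IsMotion P δ s t W) (hφ : φ ∈ kineticFragments W) {τ : ℝ}
    (hτ : τ ∈ Set.Icc s t) : φ.2.2 τ ∈ P.supportingLine δ φ.1 τ := by
  obtain ⟨L, hL, c, hc, hce, hcφ⟩ := exists_end_corner hφ
  exact hce ▸ hcφ ▸ (h.incident L hL c hc τ hτ).1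

theorem exists_end_sub_start_eq_smul (h : IsMotion P δ s t W) (hφ : φ ∈ kineticFragments W)
    {τ : ℝ} (hτ : τ ∈ Set.Ico s t) :
    ∃ l : ℝ, 0 < l ∧ φ.2.2 τ - φ.2.1 τ = l • P.direction φ.1 :=
  h.oriented τ hτ _ (mem_fragmentsAt_of_mem_kineticFragments hφ τ)

theorem of_incident_of_duration_zero
    (h : ∀ L ∈ W, ∀ c ∈ L.corners,
      c.2.2 t ∈ P.supportingLine δ c.1 t ∧ c.2.2 t ∈ P.supportingLine δ c.2.1 t) :
    IsMotion P δ t t W where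
  continuous L _ c _ := by simp
  incident L hL c hc τ hτ := by
    obtain rfl : τ = t := by simpa using hτ
    exact h L hL c hc
  bisector L _ c _ _ τ hτ := by
    obtain rfl : τ = t := by simpa using hτ
    simp
  oriented τ hτ := by simp at hτ
  planar τ hτ := by simp at hτ

end IsMotion

end Motion

section Connected

/-- The set swept during `[s, t]` by the segment with moving end points `u` and `v`. -/
def sweptSet {E : Type*} [AddCommGroup E] [Module ℝ E] (s t : ℝ) (u v : ℝ → E) : Set E :=
  ⋃ τ ∈ Set.Icc s t, segment ℝ (u τ) (v τ)

theorem isPreconnected_sweptSet {E : Type*} [AddCommGroup E] [Module ℝ E] [TopologicalSpace E]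
    [ContinuousAdd E] [ContinuousSMul ℝ E] {s t : ℝ} {u v : ℝ → E}
    (hu : ContinuousOn u (Set.Icc s t)) (hv : ContinuousOn v (Set.Icc s t)) :
    IsPreconnected (sweptSet s t u v) := by
  have himage : sweptSet s t u v = (fun z : ℝ × ℝ => (1 - z.2) • u z.1 + z.2 • v z.1) ''
      (Set.Icc s t ×ˢ Set.Icc 0 1) := by
    ext x
    simp only [sweptSet, segment_eq_image, Set.mem_iUnion, Set.mem_image, Set.mem_prod,
      Prod.exists]
    constructor
    · rintro ⟨τ, hτ, θ, hθ, rfl⟩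
      exact ⟨τ, θ, ⟨hτ, hθ⟩, rfl⟩
    · rintro ⟨τ, θ, ⟨hτ, hθ⟩, rfl⟩
      exact ⟨τ, hτ, θ, hθ, rfl⟩
  rw [himage]
  refine (isPreconnected_Icc.prod isPreconnected_Icc).image _ ?_
  have hu' : ContinuousOn (fun z : ℝ × ℝ => u z.1) (Set.Icc s t ×ˢ Set.Icc 0 1) :=
    hu.comp continuousOn_fst fun z hz => hz.1
  have hv' : ContinuousOn (fun z : ℝ × ℝ => v z.1) (Set.Icc s t ×ˢ Set.Icc 0 1) :=
    hv.comp continuousOn_fst fun z hz => hz.1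
  exact ((continuousOn_const.sub continuousOn_snd).smul hu').add (continuousOn_snd.smul hv')

namespace Propagation

variable {P : SimplePolygon n} {δ : Fin n → ℝ≥0}

theorem time_mono (W : Propagation P δ) {j k : ℕ} (hjk : j ≤ k) (hk : k ≤ W.numStages) :
    W.time j ≤ W.time k := by
  induction k, hjk using Nat.le_induction with
  | base => rfl
  | succ k _ ih => exact (ih (by omega)).trans (W.time_le k (by omega))

theorem mem_face_iff (W : Propagation P δ) {e : Fin n} {x : Plane} :
    x ∈ W.face e ↔ ∃ k < W.numStages, ∃ φ ∈ kineticFragments (W.wavefront k), φ.1 = e ∧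
      x ∈ sweptSet (W.time k) (W.time (k + 1)) φ.2.1 φ.2.2 := by
  simp only [face, edgeFragments, sweptSet, fragmentsAt_eq_map_kineticFragments, List.mem_map,
    Set.mem_iUnion, Set.mem_sUnion, Set.mem_ofPred_eq]
  constructor
  · rintro ⟨τ, -, _, ⟨k, hk, hτ, _, ⟨φ, hφ, rfl⟩, he, rfl⟩, hx⟩
    exact ⟨k, hk, φ, hφ, he, τ, hτ, hx⟩
  · rintro ⟨k, hk, φ, hφ, he, τ, hτ, hx⟩
    have hτ0 : 0 ≤ τ := W.time_zero ▸ (W.time_mono (Nat.zero_le k) hk.le).trans hτ.1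
    exact ⟨τ, hτ0, _, ⟨k, hk, hτ, _, ⟨φ, hφ, rfl⟩, he, rfl⟩, hx⟩

theorem numStages_pos (W : Propagation P δ) : 0 < W.numStages := by
  refine Nat.pos_of_ne_zero fun h => ?_
  have hinitial := W.initial
  rw [← h, W.final] at hinitial
  simp at hinitial

theorem fragmentsAt_initial (W : Propagation P δ) :
    fragmentsAt (W.wavefront 0) (W.time 0) =
      List.ofFn fun i => (i, P.vertices i, P.vertices (finRotate n i)) := by
  rw [fragmentsAt_eq_flatMap_fragments, W.initial, List.flatMap_singleton, fragments_ofFn]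

theorem vertex_mem_face (W : Propagation P δ) (e : Fin n) : P.vertices e ∈ W.face e := by
  have hmem : (e, P.vertices e, P.vertices (finRotate n e)) ∈
      fragmentsAt (W.wavefront 0) (W.time 0) := by
    rw [W.fragmentsAt_initial]
    exact List.mem_ofFn.2 ⟨e, rfl⟩
  rw [fragmentsAt_eq_map_kineticFragments] at hmem
  obtain ⟨φ, hφ, heq⟩ := List.mem_map.1 hmem
  simp only [Prod.mk.injEq] at heq
  refine W.mem_face_iff.2 ⟨0, W.numStages_pos, φ, hφ, heq.1, Set.mem_biUnion
    ⟨le_rfl, W.time_le 0 W.numStages_pos⟩ ?_⟩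
  rw [heq.2.1]
  exact left_mem_segment _ _ _

theorem sweptSet_subset_face (W : Propagation P δ) {k : ℕ} (hk : k < W.numStages)
    {φ : KineticFragment n} (hφ : φ ∈ kineticFragments (W.wavefront k)) :
    sweptSet (W.time k) (W.time (k + 1)) φ.2.1 φ.2.2 ⊆ W.face φ.1 :=
  fun _ hx => W.mem_face_iff.2 ⟨k, hk, φ, hφ, rfl, hx⟩

theorem sweptSet_subset_connectedComponentIn_of_inter_nonempty (W : Propagation P δ) {k : ℕ}
    (hk : k < W.numStages) {φ : KineticFragment n}
    (hφ : φ ∈ kineticFragments (W.wavefront k)) {x : Plane}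
    (h : (segment ℝ (φ.2.1 (W.time k)) (φ.2.2 (W.time k)) ∩
      connectedComponentIn (W.face φ.1) x).Nonempty) :
    sweptSet (W.time k) (W.time (k + 1)) φ.2.1 φ.2.2 ⊆ connectedComponentIn (W.face φ.1) x := by
  obtain ⟨y, hy, hyx⟩ := h
  rw [connectedComponentIn_eq hyx]
  have hM := W.motion k hk
  exact (isPreconnected_sweptSet (hM.continuousOn_start hφ)
    (hM.continuousOn_end hφ)).subset_connectedComponentIn
      (Set.mem_biUnion ⟨le_rfl, W.time_le k hk⟩ hy) (W.sweptSet_subset_face hk hφ)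

theorem sweptSet_subset_connectedComponentIn (W : Propagation P δ) {k : ℕ}
    (hk : k < W.numStages) {φ : KineticFragment n}
    (hφ : φ ∈ kineticFragments (W.wavefront k)) :
    sweptSet (W.time k) (W.time (k + 1)) φ.2.1 φ.2.2 ⊆
      connectedComponentIn (W.face φ.1) (P.vertices φ.1) := by
  refine W.sweptSet_subset_connectedComponentIn_of_inter_nonempty hk hφ ?_
  have hstart := mem_fragmentsAt_of_mem_kineticFragments hφ (W.time k)
  induction k generalizing φ with
  | zero =>
    rw [W.fragmentsAt_initial, List.mem_ofFn] at hstart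
    obtain ⟨e, he⟩ := hstart
    simp only [Prod.mk.injEq] at he
    obtain ⟨rfl, hp, -⟩ := he
    exact ⟨P.vertices φ.1, hp ▸ left_mem_segment _ _ _,
      mem_connectedComponentIn (W.vertex_mem_face φ.1)⟩
  | succ k ih =>
    have hk' : k < W.numStages := by omega
    rw [fragmentsAt_eq_flatMap_fragments] at hstart
    obtain ⟨g, hg, hedge, y, hy, hyg⟩ := (W.event k hk').exists_touches hstart
    rw [← fragmentsAt_eq_flatMap_fragments, fragmentsAt_eq_map_kineticFragments] at hg
    obtain ⟨ψ, hψ, rfl⟩ := List.mem_map.1 hg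
    have hpredecessor : sweptSet (W.time k) (W.time (k + 1)) ψ.2.1 ψ.2.2 ⊆
        connectedComponentIn (W.face ψ.1) (P.vertices ψ.1) :=
      W.sweptSet_subset_connectedComponentIn_of_inter_nonempty hk' hψ
        (ih hk' hψ (mem_fragmentsAt_of_mem_kineticFragments hψ _))
    rw [show φ.1 = ψ.1 from hedge]
    exact ⟨y, hy, hpredecessor (Set.mem_biUnion ⟨W.time_le k hk', le_rfl⟩ hyg)⟩

theorem isConnected_face (W : Propagation P δ) (e : Fin n) : IsConnected (W.face e) := by
  have hcomponent : connectedComponentIn (W.face e) (P.vertices e) = W.face e := by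
    refine (connectedComponentIn_subset _ _).antisymm fun x hx => ?_
    obtain ⟨k, hk, φ, hφ, rfl, hxφ⟩ := W.mem_face_iff.1 hx
    exact W.sweptSet_subset_connectedComponentIn hk hφ hxφ
  exact hcomponent ▸ isConnected_connectedComponentIn_iff.2 (W.vertex_mem_face e)

end Propagation

end Connected

section Height

theorem norm_sq_eq_cross (u : Plane) : ‖u‖ ^ 2 = cross u !₂[-u 1, u 0] := by
  rw [EuclideanSpace.real_norm_sq_eq, Fin.sum_univ_two]
  simp only [cross, Matrix.cons_val_zero, Matrix.cons_val_one]
  ring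

theorem eq_inner_smul_of_cross_eq_zero {d x : Plane} (hd : ‖d‖ = 1) (h : cross d x = 0) :
    x = inner ℝ d x • d := by
  have hd2 : d 0 * d 0 + d 1 * d 1 = 1 := by
    have := EuclideanSpace.real_norm_sq_eq d
    rw [hd, Fin.sum_univ_two] at this
    linarith
  have hcross : d 0 * x 1 - d 1 * x 0 = 0 := h
  ext i
  fin_cases i
  · simp only [Fin.zero_eta, Fin.isValue, PiLp.inner_apply, RCLike.inner_apply,
      Real.ringHom_apply, Fin.sum_univ_two, PiLp.smul_apply, smul_eq_mul]
    linear_combination (-x 0) * hd2 - d 1 * hcross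
  · simp only [Fin.mk_one, Fin.isValue, PiLp.inner_apply, RCLike.inner_apply,
      Real.ringHom_apply, Fin.sum_univ_two, PiLp.smul_apply, smul_eq_mul]
    linear_combination (-x 1) * hd2 + d 0 * hcross

theorem inner_mem_Ioo_of_mem_openSegment {E : Type*} [NormedAddCommGroup E]
    [InnerProductSpace ℝ E] {u p q x : E} (hpq : inner ℝ u p < inner ℝ u q)
    (hx : x ∈ openSegment ℝ p q) : inner ℝ u x ∈ Set.Ioo (inner ℝ u p) (inner ℝ u q) := by
  have himage := Set.mem_image_of_mem (innerₛₗ ℝ u).toAffineMap hx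
  rw [image_openSegment] at himage
  exact openSegment_eq_Ioo hpq ▸ himage

namespace SimplePolygon

variable (P : SimplePolygon n) {δ : Fin n → ℝ≥0} {e : Fin n}

theorem norm_direction (e : Fin n) : ‖P.direction e‖ = 1 := by
  have h : P.vertices (finRotate n e) - P.vertices e ≠ 0 :=
    sub_ne_zero.2 (P.nondegenerate e).symm
  rw [direction, norm_smul, norm_inv, norm_norm, inv_mul_cancel₀ (norm_ne_zero_iff.2 h)]

theorem direction_eq_of_sub_eq_smul {d : Plane} {l : ℝ} (hd : ‖d‖ = 1) (hl : 0 < l)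
    (h : P.vertices (finRotate n e) - P.vertices e = l • d) : P.direction e = d := by
  rw [direction, h, norm_smul, hd, mul_one, Real.norm_of_nonneg hl.le, inv_smul_smul₀ hl.ne']

theorem cross_direction_inwardNormal (e : Fin n) :
    cross (P.direction e) (P.inwardNormal e) = 1 := by
  rw [inwardNormal, ← norm_sq_eq_cross, P.norm_direction, one_pow]

/-- The signed distance of `x` from the supporting line of the edge `e`, positive on the inner side.
At time `t` the fragments of `e` have height `max 0 (t - δ e)`. -/
def height (e : Fin n) (x : Plane) : ℝ := cross (P.direction e) (x - P.vertices e)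

@[fun_prop]
theorem continuous_height (e : Fin n) : Continuous (P.height e) := by
  unfold height
  fun_prop

theorem height_add_smul_inwardNormal (e : Fin n) (x : Plane) (ε : ℝ) :
    P.height e (x + ε • P.inwardNormal e) = P.height e x + ε := by
  have hlin := isLinearMap_cross (P.direction e)
  rw [height, height, add_sub_right_comm, hlin.map_add, hlin.map_smul,
    cross_direction_inwardNormal, smul_eq_mul, mul_one]

theorem mem_supportingLine_iff {t : ℝ} {x : Plane} :
    x ∈ P.supportingLine δ e t ↔ P.height e x = max 0 (t - δ e) := by
  have hlin := isLinearMap_cross (P.direction e)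
  constructor
  · rintro ⟨s, rfl⟩
    have hself : cross (P.direction e) (P.direction e) = 0 := by simp [cross, mul_comm]
    rw [height_add_smul_inwardNormal, height, add_sub_cancel_left, hlin.map_smul, hself,
      smul_zero, zero_add]
  · intro hx
    have hzero : cross (P.direction e)
        (x - P.vertices e - max 0 (t - δ e) • P.inwardNormal e) = 0 := by
      rw [hlin.map_sub, hlin.map_smul, cross_direction_inwardNormal, smul_eq_mul, mul_one, ← hx,
        height, sub_self]
    have hsmul := eq_inner_smul_of_cross_eq_zero (P.norm_direction e) hzero
    exact ⟨_, sub_eq_iff_eq_add.1 (sub_eq_iff_eq_add'.1 (sub_right_comm x _ _ ▸ hsmul))⟩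

theorem convex_supportingLine (δ : Fin n → ℝ≥0) (e : Fin n) (t : ℝ) :
    Convex ℝ (P.supportingLine δ e t) := by
  have hline : P.supportingLine δ e t = {x | cross (P.direction e) x =
      cross (P.direction e) (P.vertices e) + max 0 (t - δ e)} := by
    ext x
    rw [mem_supportingLine_iff, height, (isLinearMap_cross _).map_sub, sub_eq_iff_eq_add']
    rfl
  exact hline ▸ convex_hyperplane (isLinearMap_cross _) _

theorem inner_direction_lt {p q : Plane} {l : ℝ} (hl : 0 < l) (hpq : q - p = l • P.direction e) :
    inner ℝ (P.direction e) p < inner ℝ (P.direction e) q := by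
  rw [← sub_pos, ← inner_sub_right, hpq, inner_smul_right, real_inner_self_eq_norm_sq,
    P.norm_direction, one_pow, mul_one]
  exact hl

theorem mem_segment_of_height_eq {p q x : Plane} {l : ℝ} (hl : 0 < l)
    (hpq : q - p = l • P.direction e) (hx : P.height e x = P.height e p)
    (hpx : inner ℝ (P.direction e) p ≤ inner ℝ (P.direction e) x)
    (hxq : inner ℝ (P.direction e) x ≤ inner ℝ (P.direction e) q) : x ∈ segment ℝ p q := by
  have hcross : cross (P.direction e) (x - p) = 0 := by
    rw [← sub_sub_sub_cancel_right x p (P.vertices e), (isLinearMap_cross _).map_sub]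
    exact sub_eq_zero.2 hx
  set s := inner ℝ (P.direction e) (x - p) with hs
  have hxp : x - p = s • P.direction e := eq_inner_smul_of_cross_eq_zero (P.norm_direction e) hcross
  have hs0 : 0 ≤ s := by rw [hs, inner_sub_right]; linarith
  have hsl : s ≤ l := by
    have : inner ℝ (P.direction e) (q - p) = l := by
      rw [hpq, inner_smul_right, real_inner_self_eq_norm_sq, P.norm_direction, one_pow, mul_one]
    rw [inner_sub_right] at this hs
    linarith
  rw [segment_eq_image']
  refine ⟨s / l, ⟨by positivity, (div_le_one hl).2 hsl⟩, ?_⟩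
  simp only [hpq, smul_smul, div_mul_cancel₀ _ hl.ne', ← hxp, add_sub_cancel]

end SimplePolygon

theorem IsMotion.height_eq {P : SimplePolygon n} {δ : Fin n → ℝ≥0} {s t τ : ℝ}
    {W : List (KineticPolygon n)} {φ : KineticFragment n} {x : Plane} (h : IsMotion P δ s t W)
    (hφ : φ ∈ kineticFragments W) (hτ : τ ∈ Set.Icc s t)
    (hx : x ∈ segment ℝ (φ.2.1 τ) (φ.2.2 τ)) : P.height φ.1 x = max 0 (τ - δ φ.1) :=
  P.mem_supportingLine_iff.1 <| (P.convex_supportingLine δ φ.1 τ).segment_subset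
    (h.start_mem_supportingLine hφ hτ) (h.end_mem_supportingLine hφ hτ) hx

end Height

section Interior

namespace Propagation

variable {P : SimplePolygon n} {δ : Fin n → ℝ≥0} {e : Fin n} {x : Plane}

theorem exists_mem_segment_of_mem_face (W : Propagation P δ) (hx : x ∈ W.face e) :
    ∃ k < W.numStages, ∃ τ ∈ Set.Icc (W.time k) (W.time (k + 1)),
      (∃ φ ∈ kineticFragments (W.wavefront k), φ.1 = e ∧ x ∈ segment ℝ (φ.2.1 τ) (φ.2.2 τ)) ∧
      P.height e x = max 0 (τ - δ e) := by
  obtain ⟨k, hk, φ, hφ, rfl, hxφ⟩ := W.mem_face_iff.1 hx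
  obtain ⟨τ, hτ, hxτ⟩ := Set.mem_iUnion₂.1 hxφ
  exact ⟨k, hk, τ, hτ, ⟨φ, hφ, rfl, hxτ⟩, (W.motion k hk).height_eq hφ hτ hxτ⟩

theorem height_nonneg_of_mem_face (W : Propagation P δ) (hx : x ∈ W.face e) :
    0 ≤ P.height e x := by
  obtain ⟨_, _, _, _, _, hheight⟩ := W.exists_mem_segment_of_mem_face hx
  exact hheight ▸ le_max_left _ _

theorem height_pos_of_mem_interior_face (W : Propagation P δ) (hx : x ∈ interior (W.face e)) :
    0 < P.height e x := by
  obtain ⟨ε, hε, hmem⟩ := exists_pos_add_smul_mem_of_mem_interior hx (-P.inwardNormal e)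
  have hheight := W.height_nonneg_of_mem_face hmem
  rw [smul_neg, ← neg_smul, P.height_add_smul_inwardNormal] at hheight
  linarith

theorem exists_fragment_of_mem_interior_face (W : Propagation P δ)
    (hx : x ∈ interior (W.face e)) :
    ∃ k < W.numStages, ∃ τ ∈ Set.Icc (W.time k) (W.time (k + 1)), δ e < τ ∧
      ∃ φ ∈ kineticFragments (W.wavefront k), φ.1 = e ∧ x ∈ segment ℝ (φ.2.1 τ) (φ.2.2 τ) := by
  have hpos := W.height_pos_of_mem_interior_face hx
  obtain ⟨k, hk, τ, hτ, hφ, hheight⟩ := W.exists_mem_segment_of_mem_face (interior_subset hx)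
  rw [hheight, lt_max_iff, or_iff_right (lt_irrefl _), sub_pos] at hpos
  exact ⟨k, hk, τ, hτ, hpos, hφ⟩

theorem interior_face_eq_empty_of_time_le (W : Propagation P δ) (he : W.time W.numStages ≤ δ e) :
    interior (W.face e) = ∅ := by
  refine Set.eq_empty_of_forall_notMem fun x hx => ?_
  obtain ⟨k, hk, τ, hτ, hmoving, -⟩ := W.exists_fragment_of_mem_interior_face hx
  exact (hmoving.trans_le (hτ.2.trans ((W.time_mono hk le_rfl).trans he))).false

theorem mem_face_of_eq_add_height (W : Propagation P δ) {k : ℕ} (hk : k < W.numStages)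
    {φ : KineticFragment n} (hφ : φ ∈ kineticFragments (W.wavefront k)) {τ : ℝ}
    (hτ : τ ∈ Set.Ico (W.time k) (W.time (k + 1))) (hmoving : δ φ.1 ≤ τ)
    (harrival : τ = δ φ.1 + P.height φ.1 x)
    (hpx : inner ℝ (P.direction φ.1) (φ.2.1 τ) ≤ inner ℝ (P.direction φ.1) x)
    (hxq : inner ℝ (P.direction φ.1) x ≤ inner ℝ (P.direction φ.1) (φ.2.2 τ)) :
    x ∈ W.face φ.1 := by
  have hM := W.motion k hk
  have hτ' := Set.Ico_subset_Icc_self hτ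
  obtain ⟨l, hl, hpq⟩ := hM.exists_end_sub_start_eq_smul hφ hτ
  have hheight : P.height φ.1 x = P.height φ.1 (φ.2.1 τ) := by
    rw [hM.height_eq hφ hτ' (left_mem_segment _ _ _), max_eq_right (sub_nonneg.2 hmoving),
      eq_sub_iff_add_eq', ← harrival]
  exact W.mem_face_iff.2 ⟨k, hk, φ, hφ, rfl,
    Set.mem_biUnion hτ' (P.mem_segment_of_height_eq hl hpq hheight hpx hxq)⟩

/-- The wavefront reaches a point `y` near `x` at the time `δ φ.1 + P.height φ.1 y`, which is near
`τ`. -/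
theorem mem_interior_face_of_mem_openSegment (W : Propagation P δ) {k : ℕ} (hk : k < W.numStages)
    {φ : KineticFragment n} (hφ : φ ∈ kineticFragments (W.wavefront k)) {τ : ℝ}
    (hτ : τ ∈ Set.Ioo (W.time k) (W.time (k + 1))) (hmoving : δ φ.1 < τ)
    (hx : x ∈ openSegment ℝ (φ.2.1 τ) (φ.2.2 τ)) : x ∈ interior (W.face φ.1) := by
  have hM := W.motion k hk
  have hstage : Set.Icc (W.time k) (W.time (k + 1)) ∈ nhds τ := Icc_mem_nhds hτ.1 hτ.2
  obtain ⟨l, hl, hpq⟩ := hM.exists_end_sub_start_eq_smul hφ ⟨hτ.1.le, hτ.2⟩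
  obtain ⟨hpx, hxq⟩ := inner_mem_Ioo_of_mem_openSegment (P.inner_direction_lt hl hpq) hx
  have harrival : (δ φ.1 : ℝ) + P.height φ.1 x = τ := by
    rw [hM.height_eq hφ (Set.Ioo_subset_Icc_self hτ) (openSegment_subset_segment _ _ _ hx),
      max_eq_right (sub_nonneg.2 hmoving.le), add_sub_cancel]
  have htendsto : Filter.Tendsto (fun y => (δ φ.1 : ℝ) + P.height φ.1 y) (nhds x) (nhds τ) :=
    harrival ▸ Continuous.tendsto (by fun_prop) x
  have hinner : ContinuousAt (fun y => inner ℝ (P.direction φ.1) y) x := by fun_prop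
  have hstart := (continuousAt_const (y := P.direction φ.1)).inner (𝕜 := ℝ)
    ((hM.continuousOn_start hφ).continuousAt hstage)
  have hend := (continuousAt_const (y := P.direction φ.1)).inner (𝕜 := ℝ)
    ((hM.continuousOn_end hφ).continuousAt hstage)
  rw [mem_interior_iff_mem_nhds]
  filter_upwards [htendsto.eventually_mem (Ioo_mem_nhds hτ.1 hτ.2),
    htendsto.eventually_mem (Ioi_mem_nhds hmoving),
    (hstart.tendsto.comp htendsto).eventually_lt hinner hpx,
    hinner.tendsto.eventually_lt (hend.tendsto.comp htendsto) hxq] with y hy hyδ hpy hyq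
  exact W.mem_face_of_eq_add_height hk hφ (Set.Ioo_subset_Ico_self hy) hyδ.le rfl hpy.le hyq.le

end Propagation

end Interior

section NonCrossing

theorem NonCrossing.symm {f g : Fin n × Plane × Plane} (h : NonCrossing f g) : NonCrossing g f :=
  fun x hg hf => (h x hf hg).symm.imp And.symm And.symm

theorem nonCrossing_of_oriented {e f : Fin n} {p q r u v : Plane}
    (hpq : ∃ l : ℝ, 0 < l ∧ q - p = l • u) (hqr : ∃ l : ℝ, 0 < l ∧ r - q = l • v)
    (huv : cross u v ≠ 0) : NonCrossing (e, p, q) (f, q, r) := by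
  rintro x (hx : x ∈ segment ℝ p q) (hx' : x ∈ segment ℝ q r)
  obtain ⟨l, hl, hpq⟩ := hpq
  obtain ⟨m, hm, hqr⟩ := hqr
  have hlin := isLinearMap_cross u
  have hline : cross u x = cross u q := by
    have hself : cross u u = 0 := by simp [cross, mul_comm]
    have hpline : cross u p = cross u q := by
      rw [eq_comm, ← sub_eq_zero, ← hlin.map_sub, hpq, hlin.map_smul, hself, smul_zero]
    exact (convex_hyperplane hlin (cross u q)).segment_subset hpline rfl hx
  rw [segment_eq_image'] at hx'
  obtain ⟨θ, -, rfl⟩ := hx'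
  have hθ : θ = 0 := by
    rw [hlin.map_add, hqr, hlin.map_smul, hlin.map_smul, add_eq_left] at hline
    simpa [hm.ne', huv] using hline
  exact .inl (by simp [hθ])

theorem nonCrossing_of_separated {f g : Fin n × Plane × Plane} (u : Plane) (c : ℝ)
    (hf₁ : cross u f.2.1 ≤ c) (hf₂ : cross u f.2.2 ≤ c) (hg₁ : c < cross u g.2.1)
    (hg₂ : c < cross u g.2.2) : NonCrossing f g := fun _ hf hg =>
  absurd (lt_cross_of_mem_segment hg₁ hg₂ hg) (cross_le_of_mem_segment hf₁ hf₂ hf).not_gt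

theorem pairwise_nonCrossing_triangle {e f g : Fin n} {p q r u v w : Plane}
    (hpq : ∃ l : ℝ, 0 < l ∧ q - p = l • u) (hqr : ∃ l : ℝ, 0 < l ∧ r - q = l • v)
    (hrp : ∃ l : ℝ, 0 < l ∧ p - r = l • w) (huv : cross u v ≠ 0) (hvw : cross v w ≠ 0)
    (hwu : cross w u ≠ 0) :
    [(e, p, q), (f, q, r), (g, r, p)].Pairwise NonCrossing := by
  simp only [List.pairwise_cons, List.forall_mem_cons, List.not_mem_nil, IsEmpty.forall_iff,
    implies_true, List.Pairwise.nil, and_true]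
  exact ⟨⟨nonCrossing_of_oriented hpq hqr huv, (nonCrossing_of_oriented hrp hpq hwu).symm⟩,
    nonCrossing_of_oriented hqr hrp hvw⟩

theorem edges_inter_of_pairwise_nonCrossing {P : Polygon Plane n}
    (hP : Function.Injective P.vertices)
    (h : (List.ofFn fun i => (i, P.vertices i, P.vertices (finRotate n i))).Pairwise NonCrossing)
    {i j : Fin n} (hij : i ≠ j) {x : Plane} (hi : x ∈ P.edgeSet ℝ i) (hj : x ∈ P.edgeSet ℝ j) :
    (j = finRotate n i ∧ x = P.vertices j) ∨ (i = finRotate n j ∧ x = P.vertices i) := by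
  rw [Polygon.edgeSet, affineSegment_eq_segment] at hi hj
  rw [List.pairwise_ofFn] at h
  have hnonCrossing : NonCrossing (i, P.vertices i, P.vertices (finRotate n i))
      (j, P.vertices j, P.vertices (finRotate n j)) :=
    hij.lt_or_gt.elim (fun hlt => h hlt) fun hlt => (h hlt).symm
  rcases hnonCrossing x hi hj with ⟨hxi, hxj⟩ | ⟨hxi, hxj⟩
  · exact .inl ⟨hP (hxj.symm.trans hxi), hxj⟩
  · exact .inr ⟨hP (hxi.symm.trans hxj), hxi⟩

end NonCrossing

section Coordinates

theorem exists_pos_smul_of_coord {p q u : Plane} {l : ℝ} (hl : 0 < l)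
    (h₀ : q 0 - p 0 = l * u 0) (h₁ : q 1 - p 1 = l * u 1) : ∃ l : ℝ, 0 < l ∧ q - p = l • u := by
  refine ⟨l, hl, PiLp.ext fun i => ?_⟩
  fin_cases i
  exacts [h₀, h₁]

theorem mem_openSegment_of_coord {p q x : Plane} {a b : ℝ} (ha : 0 < a) (hb : 0 < b)
    (hab : a + b = 1) (h₀ : a * p 0 + b * q 0 = x 0) (h₁ : a * p 1 + b * q 1 = x 1) :
    x ∈ openSegment ℝ p q := by
  refine ⟨a, b, ha, hb, hab, PiLp.ext fun i => ?_⟩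
  fin_cases i
  exacts [h₀, h₁]

theorem coord_mem_of_mem_segment {ι : Type*} {p q x : EuclideanSpace ℝ ι} {s : Set ℝ} {i : ι}
    (hs : Convex ℝ s) (hp : p i ∈ s) (hq : q i ∈ s) (hx : x ∈ segment ℝ p q) : x i ∈ s :=
  (hs.linear_preimage (EuclideanSpace.proj (𝕜 := ℝ) i).toLinearMap).segment_subset hp hq hx

end Coordinates

namespace SplitPentagon

/-- The vertices of the pentagon, whose edges are the floor `0`, the roof `1` of slope `-4 / 3`, the
wall `2`, the ceiling `3` of slope `-3 / 4`, and the wall `4`. -/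
def vertices : Fin 5 → Plane := ![!₂[-16, 0], !₂[27, 0], !₂[0, 36], !₂[0, 15], !₂[-16, 27]]

/-- The unit vectors in the directions of the edges. -/
def direction : Fin 5 → Plane :=
  ![!₂[1, 0], !₂[-3 / 5, 4 / 5], !₂[0, -1], !₂[-4 / 5, 3 / 5], !₂[0, -1]]

/-- The additive weights: until time `20` only the two walls move, and the wavefront has vanished
at time `24`, before the roof could start. -/
def weight : Fin 5 → ℝ≥0 := ![20, 25, 0, 20, 0]

/-- The wavefront until time `20`, when the vertex between the fragments of `2` and `3` arrives at
the floor. -/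
def pentagon : KineticPolygon 5 :=
  [(0, fun t => !₂[t - 16, 0]), (1, fun _ => !₂[27, 0]), (2, fun t => !₂[t, 36 - 4 / 3 * t]),
    (3, fun t => !₂[t, 15 - 3 / 4 * t]), (4, fun t => !₂[t - 16, 27 - 3 / 4 * t])]

/-- The part of the wavefront on the left of the line `x = 20` from time `20` to time `24`. -/
def leftTriangle : KineticPolygon 5 :=
  [(3, fun t => !₂[80 - 3 * t, t - 20]), (4, fun t => !₂[t - 16, 52 - 2 * t]),
    (0, fun t => !₂[t - 16, t - 20])]

/-- The part of the wavefront on the right of the line `x = 20` from time `20` to time `24`. -/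
def rightTriangle : KineticPolygon 5 :=
  [(0, fun t => !₂[t, t - 20]), (1, fun t => !₂[42 - 3 / 4 * t, t - 20]),
    (2, fun t => !₂[t, 36 - 4 / 3 * t])]

/-- The left triangle at time `24`, when it has collapsed, without its fragment of edge `3`. -/
def leftDigon : KineticPolygon 5 := [(4, fun _ => !₂[8, 4]), (0, fun _ => !₂[8, 4])]

/-- The right triangle at time `24`, when it has collapsed, without its fragment of edge `0`. -/
def rightDigon : KineticPolygon 5 := [(1, fun _ => !₂[24, 4]), (2, fun _ => !₂[24, 4])]

theorem weight_zero : (weight 0 : ℝ) = 20 := rfl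

theorem weight_three : (weight 3 : ℝ) = 20 := rfl

theorem corners_pentagon : pentagon.corners =
    [(0, 1, fun _ => !₂[27, 0]), (1, 2, fun t => !₂[t, 36 - 4 / 3 * t]),
      (2, 3, fun t => !₂[t, 15 - 3 / 4 * t]), (3, 4, fun t => !₂[t - 16, 27 - 3 / 4 * t]),
      (4, 0, fun t => !₂[t - 16, 0])] := rfl

theorem corners_leftTriangle : leftTriangle.corners =
    [(3, 4, fun t => !₂[t - 16, 52 - 2 * t]), (4, 0, fun t => !₂[t - 16, t - 20]),
      (0, 3, fun t => !₂[80 - 3 * t, t - 20])] := rfl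

theorem corners_rightTriangle : rightTriangle.corners =
    [(0, 1, fun t => !₂[42 - 3 / 4 * t, t - 20]), (1, 2, fun t => !₂[t, 36 - 4 / 3 * t]),
      (2, 0, fun t => !₂[t, t - 20])] := rfl

theorem corners_leftDigon : leftDigon.corners =
    [(4, 0, fun _ => !₂[8, 4]), (0, 4, fun _ => !₂[8, 4])] := rfl

theorem corners_rightDigon : rightDigon.corners =
    [(1, 2, fun _ => !₂[24, 4]), (2, 1, fun _ => !₂[24, 4])] := rfl

theorem fragmentsAt_pentagon (t : ℝ) : fragmentsAt [pentagon] t =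
    [(0, !₂[t - 16, 0], !₂[27, 0]), (1, !₂[27, 0], !₂[t, 36 - 4 / 3 * t]),
      (2, !₂[t, 36 - 4 / 3 * t], !₂[t, 15 - 3 / 4 * t]),
      (3, !₂[t, 15 - 3 / 4 * t], !₂[t - 16, 27 - 3 / 4 * t]),
      (4, !₂[t - 16, 27 - 3 / 4 * t], !₂[t - 16, 0])] := rfl

theorem fragmentsAt_leftTriangle (t : ℝ) : fragmentsAt [leftTriangle] t =
    [(3, !₂[80 - 3 * t, t - 20], !₂[t - 16, 52 - 2 * t]),
      (4, !₂[t - 16, 52 - 2 * t], !₂[t - 16, t - 20]),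
      (0, !₂[t - 16, t - 20], !₂[80 - 3 * t, t - 20])] := rfl

theorem fragmentsAt_rightTriangle (t : ℝ) : fragmentsAt [rightTriangle] t =
    [(0, !₂[t, t - 20], !₂[42 - 3 / 4 * t, t - 20]),
      (1, !₂[42 - 3 / 4 * t, t - 20], !₂[t, 36 - 4 / 3 * t]),
      (2, !₂[t, 36 - 4 / 3 * t], !₂[t, t - 20])] := rfl

theorem fragmentsAt_leftDigon (t : ℝ) : fragmentsAt [leftDigon] t =
    [(4, !₂[8, 4], !₂[8, 4]), (0, !₂[8, 4], !₂[8, 4])] := rfl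

theorem fragmentsAt_rightDigon (t : ℝ) : fragmentsAt [rightDigon] t =
    [(1, !₂[24, 4], !₂[24, 4]), (2, !₂[24, 4], !₂[24, 4])] := rfl

theorem fragmentsAt_triangles (t : ℝ) : fragmentsAt [leftTriangle, rightTriangle] t =
    fragmentsAt [leftTriangle] t ++ fragmentsAt [rightTriangle] t := rfl

theorem oriented_pentagon {t : ℝ} (ht : t < 20) :
    ∀ f ∈ fragmentsAt [pentagon] t, ∃ l : ℝ, 0 < l ∧ f.2.2 - f.2.1 = l • direction f.1 := by
  simp only [fragmentsAt_pentagon, List.forall_mem_cons, List.not_mem_nil, IsEmpty.forall_iff,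
    implies_true, and_true]
  refine ⟨exists_pos_smul_of_coord (l := 43 - t) ?_ ?_ ?_,
    exists_pos_smul_of_coord (l := 45 - 5 / 3 * t) ?_ ?_ ?_,
    exists_pos_smul_of_coord (l := 21 - 7 / 12 * t) ?_ ?_ ?_,
    exists_pos_smul_of_coord (l := 20) ?_ ?_ ?_,
    exists_pos_smul_of_coord (l := 27 - 3 / 4 * t) ?_ ?_ ?_⟩ <;> simp [direction] <;> linarith

theorem oriented_leftTriangle {t : ℝ} (ht : t < 24) :
    ∀ f ∈ fragmentsAt [leftTriangle] t, ∃ l : ℝ, 0 < l ∧ f.2.2 - f.2.1 = l • direction f.1 := by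
  simp only [fragmentsAt_leftTriangle, List.forall_mem_cons, List.not_mem_nil, IsEmpty.forall_iff,
    implies_true, and_true]
  refine ⟨exists_pos_smul_of_coord (l := 120 - 5 * t) ?_ ?_ ?_,
    exists_pos_smul_of_coord (l := 72 - 3 * t) ?_ ?_ ?_,
    exists_pos_smul_of_coord (l := 96 - 4 * t) ?_ ?_ ?_⟩ <;> simp [direction] <;> linarith

theorem oriented_rightTriangle {t : ℝ} (ht : t < 24) :
    ∀ f ∈ fragmentsAt [rightTriangle] t, ∃ l : ℝ, 0 < l ∧ f.2.2 - f.2.1 = l • direction f.1 := by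
  simp only [fragmentsAt_rightTriangle, List.forall_mem_cons, List.not_mem_nil, IsEmpty.forall_iff,
    implies_true, and_true]
  refine ⟨exists_pos_smul_of_coord (l := 42 - 7 / 4 * t) ?_ ?_ ?_,
    exists_pos_smul_of_coord (l := 70 - 35 / 12 * t) ?_ ?_ ?_,
    exists_pos_smul_of_coord (l := 56 - 7 / 3 * t) ?_ ?_ ?_⟩ <;> simp [direction] <;> linarith

theorem pairwise_nonCrossing_pentagon {t : ℝ} (ht : t < 20) :
    (fragmentsAt [pentagon] t).Pairwise NonCrossing := by
  have horiented := oriented_pentagon ht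
  simp only [fragmentsAt_pentagon, List.forall_mem_cons, List.pairwise_cons, List.not_mem_nil,
    IsEmpty.forall_iff, implies_true, List.Pairwise.nil, and_true] at horiented ⊢
  obtain ⟨hf₀, hf₁, hf₂, hf₃, hf₄⟩ := horiented
  refine ⟨⟨nonCrossing_of_oriented hf₀ hf₁ ?_, nonCrossing_of_separated !₂[1, 0] 0 ?_ ?_ ?_ ?_,
    nonCrossing_of_separated !₂[1, 0] 0 ?_ ?_ ?_ ?_, (nonCrossing_of_oriented hf₄ hf₀ ?_).symm⟩,
    ⟨nonCrossing_of_oriented hf₁ hf₂ ?_, (nonCrossing_of_separated !₂[4, -3] 60 ?_ ?_ ?_ ?_).symm,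
      (nonCrossing_of_separated !₂[0, -1] (t - 16) ?_ ?_ ?_ ?_).symm⟩,
    ⟨nonCrossing_of_oriented hf₂ hf₃ ?_,
      (nonCrossing_of_separated !₂[0, -1] (t - 16) ?_ ?_ ?_ ?_).symm⟩,
    nonCrossing_of_oriented hf₃ hf₄ ?_⟩ <;> simp [cross, direction] <;> linarith

theorem pairwise_nonCrossing_leftTriangle {t : ℝ} (ht : t < 24) :
    (fragmentsAt [leftTriangle] t).Pairwise NonCrossing := by
  have horiented := oriented_leftTriangle ht
  simp only [fragmentsAt_leftTriangle, List.forall_mem_cons, List.not_mem_nil, IsEmpty.forall_iff,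
    implies_true, and_true] at horiented ⊢
  obtain ⟨hf₃, hf₄, hf₀⟩ := horiented
  apply pairwise_nonCrossing_triangle hf₃ hf₄ hf₀ <;> simp [cross, direction]

theorem pairwise_nonCrossing_rightTriangle {t : ℝ} (ht : t < 24) :
    (fragmentsAt [rightTriangle] t).Pairwise NonCrossing := by
  have horiented := oriented_rightTriangle ht
  simp only [fragmentsAt_rightTriangle, List.forall_mem_cons, List.not_mem_nil, IsEmpty.forall_iff,
    implies_true, and_true] at horiented ⊢
  obtain ⟨hf₀, hf₁, hf₂⟩ := horiented
  apply pairwise_nonCrossing_triangle hf₀ hf₁ hf₂ <;> simp [cross, direction]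

theorem coord_mem_of_mem_leftTriangle {t : ℝ} (ht : t ∈ Set.Ioc (20 : ℝ) 24) :
    ∀ f ∈ fragmentsAt [leftTriangle] t, f.2.1 0 ∈ Set.Ico 4 20 ∧ f.2.2 0 ∈ Set.Ico 4 20 := by
  obtain ⟨h₀, h₁⟩ := ht
  simp only [fragmentsAt_leftTriangle, List.forall_mem_cons, List.not_mem_nil, IsEmpty.forall_iff,
    implies_true, and_true, Matrix.cons_val_zero, Set.mem_Ico]
  refine ⟨⟨⟨?_, ?_⟩, ?_, ?_⟩, ⟨⟨?_, ?_⟩, ?_, ?_⟩, ⟨?_, ?_⟩, ?_, ?_⟩ <;> linarith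

theorem coord_mem_of_mem_rightTriangle {t : ℝ} (ht : t ∈ Set.Ioc (20 : ℝ) 24) :
    ∀ f ∈ fragmentsAt [rightTriangle] t, f.2.1 0 ∈ Set.Ioi 20 ∧ f.2.2 0 ∈ Set.Ioi 20 := by
  obtain ⟨h₀, h₁⟩ := ht
  simp only [fragmentsAt_rightTriangle, List.forall_mem_cons, List.not_mem_nil, IsEmpty.forall_iff,
    implies_true, and_true, Matrix.cons_val_zero, Set.mem_Ioi]
  refine ⟨⟨?_, ?_⟩, ⟨?_, ?_⟩, ?_, ?_⟩ <;> linarith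

theorem coord_mem_of_mem_leftDigon {t : ℝ} :
    ∀ f ∈ fragmentsAt [leftDigon] t, f.2.1 0 ∈ Set.Ico 4 20 ∧ f.2.2 0 ∈ Set.Ico 4 20 := by
  simp only [fragmentsAt_leftDigon, List.forall_mem_cons, List.not_mem_nil, IsEmpty.forall_iff,
    implies_true, and_true, Matrix.cons_val_zero, Set.mem_Ico]
  norm_num

theorem coord_mem_of_mem_rightDigon {t : ℝ} :
    ∀ f ∈ fragmentsAt [rightDigon] t, f.2.1 0 ∈ Set.Ioi 20 ∧ f.2.2 0 ∈ Set.Ioi 20 := by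
  simp only [fragmentsAt_rightDigon, List.forall_mem_cons, List.not_mem_nil, IsEmpty.forall_iff,
    implies_true, and_true, Matrix.cons_val_zero, Set.mem_Ioi]
  norm_num

theorem pairwise_nonCrossing_triangles {t : ℝ} (ht : t ∈ Set.Ioo (20 : ℝ) 24) :
    (fragmentsAt [leftTriangle, rightTriangle] t).Pairwise NonCrossing := by
  rw [fragmentsAt_triangles, List.pairwise_append]
  refine ⟨pairwise_nonCrossing_leftTriangle ht.2, pairwise_nonCrossing_rightTriangle ht.2,
    fun f hf g hg => ?_⟩
  have ht' := Set.Ioo_subset_Ioc_self ht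
  obtain ⟨⟨-, hf₁⟩, -, hf₂⟩ := coord_mem_of_mem_leftTriangle ht' f hf
  obtain ⟨hg₁, hg₂⟩ := coord_mem_of_mem_rightTriangle ht' g hg
  have hcross (x : Plane) : cross !₂[0, -1] x = x 0 := by simp [cross]
  apply nonCrossing_of_separated !₂[0, -1] 20 <;> rw [hcross]
  exacts [hf₁.le, hf₂.le, hg₁, hg₂]

theorem injective_vertices : Function.Injective vertices := by
  intro i j hij
  have h₀ := congrArg (fun p : Plane => p 0) hij
  have h₁ := congrArg (fun p : Plane => p 1) hij
  fin_cases i <;> fin_cases j <;>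
    first
    | rfl
    | (norm_num [vertices] at h₀; done)
    | (norm_num [vertices] at h₁)

theorem initial_pentagon : [pentagon].map (fun L => L.at 0) =
    [List.ofFn fun i => (i, vertices i)] := by
  simp [pentagon, KineticPolygon.at, vertices]

/-- The input polygon. -/
def polygon : SimplePolygon 5 where
  vertices := vertices
  three_le := by norm_num
  nondegenerate i h := by
    have hne : ∀ i : Fin 5, i ≠ finRotate 5 i := by decide
    exact hne i (injective_vertices h)
  edges_inter i j hij x hi hj := by
    refine edges_inter_of_pairwise_nonCrossing injective_vertices ?_ hij hi hj
    have hplanar := pairwise_nonCrossing_pentagon (t := 0) (by norm_num)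
    rwa [fragmentsAt_eq_flatMap_fragments, initial_pentagon, List.flatMap_singleton,
      fragments_ofFn] at hplanar
  counterclockwise := by
    simp [Fin.sum_univ_five, vertices, cross, finRotate_apply]
    norm_num

theorem polygon_direction (e : Fin 5) : polygon.direction e = direction e := by
  have hmem : (e, vertices e, vertices (finRotate 5 e)) ∈ fragmentsAt [pentagon] 0 := by
    rw [fragmentsAt_eq_flatMap_fragments, initial_pentagon, List.flatMap_singleton, fragments_ofFn]
    exact List.mem_ofFn.2 ⟨e, rfl⟩
  obtain ⟨l, hl, h⟩ := oriented_pentagon (by norm_num) _ hmem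
  refine polygon.direction_eq_of_sub_eq_smul ?_ hl h
  rw [EuclideanSpace.norm_eq, Real.sqrt_eq_one, Fin.sum_univ_two]
  fin_cases e <;> norm_num [direction]

theorem polygon_height (e : Fin 5) (x : Plane) : polygon.height e x =
    (![x 1, (108 - 4 * x 0 - 3 * x 1) / 5, x 0, (60 - 3 * x 0 - 4 * x 1) / 5, x 0 + 16] :
      Fin 5 → ℝ) e := by
  rw [SimplePolygon.height, polygon_direction]
  fin_cases e <;> simp [cross, direction, polygon, vertices] <;> ring


theorem mem_supportingLine_iff {e : Fin 5} {t : ℝ} {x : Plane} :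
    x ∈ polygon.supportingLine weight e t ↔
      (![x 1, (108 - 4 * x 0 - 3 * x 1) / 5, x 0, (60 - 3 * x 0 - 4 * x 1) / 5, x 0 + 16] :
        Fin 5 → ℝ) e = (![max 0 (t - 20), max 0 (t - 25), max 0 t, max 0 (t - 20), max 0 t] :
        Fin 5 → ℝ) e := by
  rw [SimplePolygon.mem_supportingLine_iff, polygon_height]
  fin_cases e <;> simp [weight]

theorem incident_pentagon {t : ℝ} (ht : t ∈ Set.Icc (0 : ℝ) 20) :
    ∀ c ∈ pentagon.corners, c.2.2 t ∈ polygon.supportingLine weight c.1 t ∧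
      c.2.2 t ∈ polygon.supportingLine weight c.2.1 t := by
  obtain ⟨h₀, h₁⟩ := ht
  have hwall : max 0 t = t := max_eq_right h₀
  have hfloor : max 0 (t - 20) = 0 := max_eq_left (by linarith)
  have hroof : max 0 (t - 25) = 0 := max_eq_left (by linarith)
  simp only [corners_pentagon, mem_supportingLine_iff, hwall, hfloor, hroof, List.forall_mem_cons,
    List.not_mem_nil, IsEmpty.forall_iff, implies_true, and_true]
  refine ⟨⟨?_, ?_⟩, ⟨?_, ?_⟩, ⟨?_, ?_⟩, ⟨?_, ?_⟩, ?_, ?_⟩ <;> simp <;> linarith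

theorem incident_leftTriangle {t : ℝ} (ht : 20 ≤ t) :
    ∀ c ∈ leftTriangle.corners, c.2.2 t ∈ polygon.supportingLine weight c.1 t ∧
      c.2.2 t ∈ polygon.supportingLine weight c.2.1 t := by
  have hwall : max 0 t = t := max_eq_right (by linarith)
  have hfloor : max 0 (t - 20) = t - 20 := max_eq_right (by linarith)
  simp only [corners_leftTriangle, mem_supportingLine_iff, hwall, hfloor, List.forall_mem_cons,
    List.not_mem_nil, IsEmpty.forall_iff, implies_true, and_true]
  refine ⟨⟨?_, ?_⟩, ⟨?_, ?_⟩, ?_, ?_⟩ <;> simp <;> linarith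

theorem incident_rightTriangle {t : ℝ} (ht : t ∈ Set.Icc (20 : ℝ) 24) :
    ∀ c ∈ rightTriangle.corners, c.2.2 t ∈ polygon.supportingLine weight c.1 t ∧
      c.2.2 t ∈ polygon.supportingLine weight c.2.1 t := by
  obtain ⟨h₀, h₁⟩ := ht
  have hwall : max 0 t = t := max_eq_right (by linarith)
  have hfloor : max 0 (t - 20) = t - 20 := max_eq_right (by linarith)
  have hroof : max 0 (t - 25) = 0 := max_eq_left (by linarith)
  simp only [corners_rightTriangle, mem_supportingLine_iff, hwall, hfloor, hroof,
    List.forall_mem_cons, List.not_mem_nil, IsEmpty.forall_iff, implies_true, and_true]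
  refine ⟨⟨?_, ?_⟩, ⟨?_, ?_⟩, ?_, ?_⟩ <;> simp <;> linarith

theorem incident_leftDigon :
    ∀ c ∈ leftDigon.corners, c.2.2 24 ∈ polygon.supportingLine weight c.1 24 ∧
      c.2.2 24 ∈ polygon.supportingLine weight c.2.1 24 := by
  simp only [corners_leftDigon, mem_supportingLine_iff, List.forall_mem_cons, List.not_mem_nil,
    IsEmpty.forall_iff, implies_true, and_true]
  refine ⟨⟨?_, ?_⟩, ?_, ?_⟩ <;> simp <;> norm_num

theorem incident_rightDigon :
    ∀ c ∈ rightDigon.corners, c.2.2 24 ∈ polygon.supportingLine weight c.1 24 ∧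
      c.2.2 24 ∈ polygon.supportingLine weight c.2.1 24 := by
  simp only [corners_rightDigon, mem_supportingLine_iff, List.forall_mem_cons, List.not_mem_nil,
    IsEmpty.forall_iff, implies_true, and_true]
  refine ⟨⟨?_, ?_⟩, ?_, ?_⟩ <;> simp <;> norm_num

theorem cross_direction_ne_zero_pentagon : ∀ c ∈ pentagon.corners,
    cross (polygon.direction c.1) (polygon.direction c.2.1) ≠ 0 := by
  simp only [corners_pentagon, polygon_direction, List.forall_mem_cons, List.not_mem_nil,
    IsEmpty.forall_iff, implies_true, and_true]
  refine ⟨?_, ?_, ?_, ?_, ?_⟩ <;> simp [cross, direction]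

theorem cross_direction_ne_zero_leftTriangle : ∀ c ∈ leftTriangle.corners,
    cross (polygon.direction c.1) (polygon.direction c.2.1) ≠ 0 := by
  simp only [corners_leftTriangle, polygon_direction, List.forall_mem_cons, List.not_mem_nil,
    IsEmpty.forall_iff, implies_true, and_true]
  refine ⟨?_, ?_, ?_⟩ <;> simp [cross, direction]

theorem cross_direction_ne_zero_rightTriangle : ∀ c ∈ rightTriangle.corners,
    cross (polygon.direction c.1) (polygon.direction c.2.1) ≠ 0 := by
  simp only [corners_rightTriangle, polygon_direction, List.forall_mem_cons, List.not_mem_nil,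
    IsEmpty.forall_iff, implies_true, and_true]
  refine ⟨?_, ?_, ?_⟩ <;> simp [cross, direction]

theorem isMotion_pentagon : IsMotion polygon weight 0 20 [pentagon] where
  continuous := by
    simp only [List.forall_mem_singleton, corners_pentagon, List.forall_mem_cons]
    exact ⟨by fun_prop, by fun_prop, by fun_prop, by fun_prop, by fun_prop⟩
  incident := List.forall_mem_singleton.2 fun c hc τ hτ => incident_pentagon hτ c hc
  bisector := List.forall_mem_singleton.2 fun c hc hparallel =>
    absurd hparallel (cross_direction_ne_zero_pentagon c hc)
  oriented τ hτ := by
    simpa only [polygon_direction] using oriented_pentagon hτ.2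
  planar τ hτ := pairwise_nonCrossing_pentagon hτ.2

theorem isMotion_triangles : IsMotion polygon weight 20 24 [leftTriangle, rightTriangle] where
  continuous := by
    simp only [List.forall_mem_cons, corners_leftTriangle, corners_rightTriangle, List.not_mem_nil,
      IsEmpty.forall_iff, implies_true, and_true]
    exact ⟨⟨by fun_prop, by fun_prop, by fun_prop⟩, by fun_prop, by fun_prop, by fun_prop⟩
  incident := List.forall_mem_cons.2 ⟨fun c hc τ hτ => incident_leftTriangle hτ.1 c hc,
    List.forall_mem_singleton.2 fun c hc τ hτ => incident_rightTriangle hτ c hc⟩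
  bisector := List.forall_mem_cons.2
    ⟨fun c hc hparallel => absurd hparallel (cross_direction_ne_zero_leftTriangle c hc),
      List.forall_mem_singleton.2 fun c hc hparallel =>
        absurd hparallel (cross_direction_ne_zero_rightTriangle c hc)⟩
  oriented τ hτ := by
    simp only [polygon_direction, fragmentsAt_triangles, List.forall_mem_append]
    exact ⟨oriented_leftTriangle hτ.2, oriented_rightTriangle hτ.2⟩
  planar τ hτ := pairwise_nonCrossing_triangles hτ

theorem splitEvent_pentagon : WavefrontEvent polygon weight 20
    ([pentagon].map fun L => L.at 20) ([leftTriangle, rightTriangle].map fun L => L.at 20) := by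
  have hmem : (!₂[20, 0] : Plane) ∈ openSegment ℝ !₂[4, 0] !₂[27, 0] :=
    mem_openSegment_of_coord (a := 7 / 23) (b := 16 / 23) (by norm_num) (by norm_num)
      (by norm_num) (by norm_num) (by norm_num)
  have h := WavefrontEvent.polygon (P := polygon) (δ := weight) (t := 20) [] []
    [(0, !₂[4, 0]), (1, !₂[27, 0]), (2, !₂[20, 28 / 3]), (3, !₂[20, 0]), (4, !₂[4, 12])] _ _
    ⟨3, rfl⟩ (PolygonEvent.split 3 0 1 _ _ _ [(4, !₂[4, 12])] [(2, !₂[20, 28 / 3])]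
      (openSegment_subset_segment ℝ _ _ hmem))
  convert h using 1 <;> norm_num [pentagon, leftTriangle, rightTriangle, KineticPolygon.at]

theorem edgeEvent_leftTriangle : WavefrontEvent polygon weight 24
    ([leftTriangle, rightTriangle].map fun L => L.at 24)
    ([leftDigon, rightTriangle].map fun L => L.at 24) := by
  have h := WavefrontEvent.polygon (P := polygon) (δ := weight) (t := 24) []
    [rightTriangle.at 24] _ _ _ (List.IsRotated.refl _)
    (PolygonEvent.edge 3 4 !₂[8, 4] [(0, !₂[8, 4])])
  convert h using 1 <;> norm_num [leftDigon, leftTriangle, KineticPolygon.at]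

theorem collapse_leftDigon : WavefrontEvent polygon weight 24
    ([leftDigon, rightTriangle].map fun L => L.at 24) ([rightTriangle].map fun L => L.at 24) :=
  WavefrontEvent.polygon [] [rightTriangle.at 24] _ _ [] (List.IsRotated.refl _)
    (PolygonEvent.collapse _ le_rfl)

theorem edgeEvent_rightTriangle : WavefrontEvent polygon weight 24
    ([rightTriangle].map fun L => L.at 24) ([rightDigon].map fun L => L.at 24) := by
  have h := WavefrontEvent.polygon (P := polygon) (δ := weight) (t := 24) [] [] _ _ _
    (List.IsRotated.refl _) (PolygonEvent.edge 0 1 !₂[24, 4] [(2, !₂[24, 4])])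
  convert h using 1 <;> norm_num [rightDigon, rightTriangle, KineticPolygon.at]

theorem collapse_rightDigon : WavefrontEvent polygon weight 24
    ([rightDigon].map fun L => L.at 24) [] :=
  WavefrontEvent.polygon [] [] _ _ [] (List.IsRotated.refl _) (PolygonEvent.collapse _ le_rfl)

/-- The times at which the stages of the propagation begin. The stages from `1` to `2`, of duration
zero, end with the speed changes of the floor and of the ceiling. -/
def time : ℕ → ℝ
  | 0 => 0
  | 1 | 2 | 3 => 20
  | _ => 24

/-- The wavefront during each of the stages of the propagation. -/
def wavefront : ℕ → List (KineticPolygon 5)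
  | 0 => [pentagon]
  | 1 | 2 | 3 => [leftTriangle, rightTriangle]
  | 4 => [leftDigon, rightTriangle]
  | 5 => [rightTriangle]
  | 6 => [rightDigon]
  | _ => []

/-- A propagation in which the roof never moves, the fragment of the floor is split at time `20`,
before it starts to move, and the fragment of the ceiling has by then slid off the ceiling. -/
def propagation : Propagation polygon weight where
  numStages := 7
  time := time
  wavefront := wavefront
  time_zero := rfl
  time_le k hk := by interval_cases k <;> norm_num [time]
  initial := initial_pentagon
  motion k hk := by
    have hright := incident_rightTriangle (t := 24) (by norm_num)
    have htriangles : IsMotion polygon weight 20 20 [leftTriangle, rightTriangle] :=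
      .of_incident_of_duration_zero <| List.forall_mem_cons.2
        ⟨incident_leftTriangle le_rfl,
          List.forall_mem_singleton.2 (incident_rightTriangle (by norm_num))⟩
    interval_cases k
    · exact isMotion_pentagon
    · exact htriangles
    · exact htriangles
    · exact isMotion_triangles
    · exact .of_incident_of_duration_zero <| List.forall_mem_cons.2
        ⟨incident_leftDigon, List.forall_mem_singleton.2 hright⟩
    · exact .of_incident_of_duration_zero <| List.forall_mem_singleton.2 hright
    · exact .of_incident_of_duration_zero <| List.forall_mem_singleton.2 incident_rightDigon
  event k hk := by
    interval_cases k
    · exact splitEvent_pentagon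
    · exact WavefrontEvent.speedChange 0 weight_zero _
    · exact WavefrontEvent.speedChange 3 weight_three _
    · exact edgeEvent_leftTriangle
    · exact collapse_leftDigon
    · exact edgeEvent_rightTriangle
    · exact collapse_rightDigon
  final := rfl

theorem coord_mem_of_mem_fragmentsAt_wavefront {k : ℕ} (hk : k < 7) {t : ℝ}
    (ht : t ∈ Set.Icc (time k) (time (k + 1))) (hlate : 20 < t) :
    ∀ f ∈ fragmentsAt (wavefront k) t,
      (f.2.1 0 ∈ Set.Ico (4 : ℝ) 20 ∧ f.2.2 0 ∈ Set.Ico (4 : ℝ) 20) ∨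
        (f.2.1 0 ∈ Set.Ioi (20 : ℝ) ∧ f.2.2 0 ∈ Set.Ioi (20 : ℝ)) := by
  intro f hf
  have hearly (h : time (k + 1) = 20) : False := (hlate.trans_le ht.2).ne' h
  interval_cases k
  · exact (hearly rfl).elim
  · exact (hearly rfl).elim
  · exact (hearly rfl).elim
  · rcases List.mem_append.1 (fragmentsAt_triangles t ▸ hf) with hf | hf
    · exact .inl (coord_mem_of_mem_leftTriangle ⟨hlate, ht.2⟩ f hf)
    · exact .inr (coord_mem_of_mem_rightTriangle ⟨hlate, ht.2⟩ f hf)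
  · rcases List.mem_append.1
      (show f ∈ fragmentsAt [leftDigon] t ++ fragmentsAt [rightTriangle] t from hf) with hf | hf
    · exact .inl (coord_mem_of_mem_leftDigon f hf)
    · exact .inr (coord_mem_of_mem_rightTriangle ⟨hlate, ht.2⟩ f hf)
  · exact .inr (coord_mem_of_mem_rightTriangle ⟨hlate, ht.2⟩ f hf)
  · exact .inr (coord_mem_of_mem_rightDigon f hf)

theorem coord_mem_of_mem_interior_face {e : Fin 5} (he : 20 ≤ weight e) {x : Plane}
    (hx : x ∈ interior (propagation.face e)) :
    x 0 ∈ Set.Ico (4 : ℝ) 20 ∨ x 0 ∈ Set.Ioi (20 : ℝ) := by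
  obtain ⟨k, hk, τ, hτ, hmoving, φ, hφ, -, hxφ⟩ :=
    propagation.exists_fragment_of_mem_interior_face hx
  have hlate : (20 : ℝ) < τ := lt_of_le_of_lt (by exact_mod_cast he) hmoving
  rcases coord_mem_of_mem_fragmentsAt_wavefront hk hτ hlate _
    (mem_fragmentsAt_of_mem_kineticFragments hφ τ) with ⟨hp, hq⟩ | ⟨hp, hq⟩
  · exact .inl (coord_mem_of_mem_segment (convex_Ico 4 20) hp hq hxφ)
  · exact .inr (coord_mem_of_mem_segment (convex_Ioi 20) hp hq hxφ)

theorem mem_interior_face_of_mem_triangles {φ : KineticFragment 5}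
    (hφ : φ ∈ kineticFragments [leftTriangle, rightTriangle]) (he : weight φ.1 ≤ 20) {x : Plane}
    (hx : x ∈ openSegment ℝ (φ.2.1 22) (φ.2.2 22)) : x ∈ interior (propagation.face φ.1) := by
  have hstage : (22 : ℝ) ∈ Set.Ioo (time 3) (time 4) := by norm_num [time]
  have hmoving : (weight φ.1 : ℝ) ≤ 20 := by exact_mod_cast he
  exact propagation.mem_interior_face_of_mem_openSegment (k := 3) (by decide) hφ hstage
    (hmoving.trans_lt (by norm_num)) hx

theorem mem_interior_face_floor_left : !₂[10, 2] ∈ interior (propagation.face 0) := by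
  refine mem_interior_face_of_mem_triangles
    (φ := (0, fun t => !₂[t - 16, t - 20], fun t => !₂[80 - 3 * t, t - 20]))
    (.tail _ (.tail _ (.head _))) le_rfl ?_
  apply mem_openSegment_of_coord (a := 1 / 2) (b := 1 / 2) <;> norm_num

theorem mem_interior_face_floor_right : !₂[95 / 4, 2] ∈ interior (propagation.face 0) := by
  refine mem_interior_face_of_mem_triangles
    (φ := (0, fun t => !₂[t, t - 20], fun t => !₂[42 - 3 / 4 * t, t - 20]))
    (.tail _ (.tail _ (.tail _ (.head _)))) le_rfl ?_
  apply mem_openSegment_of_coord (a := 1 / 2) (b := 1 / 2) <;> norm_num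

theorem mem_interior_face_ceiling : !₂[10, 5] ∈ interior (propagation.face 3) := by
  refine mem_interior_face_of_mem_triangles
    (φ := (3, fun t => !₂[80 - 3 * t, t - 20], fun t => !₂[t - 16, 52 - 2 * t]))
    (.head _) le_rfl ?_
  apply mem_openSegment_of_coord (a := 1 / 2) (b := 1 / 2) <;> norm_num

theorem interior_face_roof : interior (propagation.face 1) = ∅ :=
  propagation.interior_face_eq_empty_of_time_le (show (24 : ℝ) ≤ 25 by norm_num)

theorem not_isPreconnected_interior_face_floor :
    ¬ IsPreconnected (interior (propagation.face 0)) := by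
  intro hconnected
  have hcontinuous : Continuous fun x : Plane => x 0 := by fun_prop
  have hmem : (20 : ℝ) ∈ Set.Icc ((!₂[10, 2] : Plane) 0) ((!₂[95 / 4, 2] : Plane) 0) := by
    norm_num
  obtain ⟨x, hx, hx₀⟩ := hconnected.intermediate_value mem_interior_face_floor_left
    mem_interior_face_floor_right hcontinuous.continuousOn hmem
  have hcoord := coord_mem_of_mem_interior_face le_rfl hx
  rw [show x 0 = 20 from hx₀] at hcoord
  norm_num at hcoord

theorem disjoint_closure_interior_face_ceiling :
    Disjoint (closure (interior (propagation.face 3))) (polygon.edgeSet ℝ 3) := by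
  have hclosed : IsClosed {x : Plane | 4 ≤ x 0} := isClosed_le (by fun_prop) (by fun_prop)
  have four_lt_twenty : (4 : ℝ) < 20 := by norm_num
  have hclosure : closure (interior (propagation.face 3)) ⊆ {x | 4 ≤ x 0} := by
    refine closure_minimal (fun x hx => ?_) hclosed
    exact (coord_mem_of_mem_interior_face le_rfl hx).elim And.left fun h =>
      (four_lt_twenty.trans h).le
  refine Set.disjoint_left.2 fun x hx hedge => ?_
  rw [Polygon.edgeSet, affineSegment_eq_segment] at hedge
  have hstart : polygon.vertices 3 0 ∈ Set.Iic (0 : ℝ) :=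
    show (0 : ℝ) ≤ 0 from le_rfl
  have hend : polygon.vertices (finRotate 5 3) 0 ∈ Set.Iic (0 : ℝ) :=
    show (-16 : ℝ) ≤ 0 by norm_num
  have hx₀ : x 0 ≤ 0 := coord_mem_of_mem_segment (convex_Iic 0) hstart hend hedge
  have hx₄ : 4 ≤ x 0 := hclosure hx
  linarith

end SplitPentagon

end StraightSkeleton

end

theorem mainTheorem6 :
    (∀ (n : ℕ) (P : StraightSkeleton.SimplePolygon n) (δ : Fin n → ℝ≥0)
      (W : StraightSkeleton.Propagation P δ) (e : Fin n), IsConnected (W.face e)) ∧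
    (∃ (n : ℕ) (P : StraightSkeleton.SimplePolygon n) (δ : Fin n → ℝ≥0)
      (W : StraightSkeleton.Propagation P δ) (e : Fin n), interior (W.face e) = ∅) ∧
    (∃ (n : ℕ) (P : StraightSkeleton.SimplePolygon n) (δ : Fin n → ℝ≥0)
      (W : StraightSkeleton.Propagation P δ) (e : Fin n),
      (interior (W.face e)).Nonempty ∧ ¬ IsPreconnected (interior (W.face e))) ∧
    (∃ (n : ℕ) (P : StraightSkeleton.SimplePolygon n) (δ : Fin n → ℝ≥0)
      (W : StraightSkeleton.Propagation P δ) (e : Fin n),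
      (interior (W.face e)).Nonempty ∧
        Disjoint (closure (interior (W.face e))) (P.edgeSet ℝ e)) :=
  open StraightSkeleton SplitPentagon in
  ⟨fun _ _ _ W e => W.isConnected_face e,
    ⟨5, polygon, weight, propagation, 1, interior_face_roof⟩,
    ⟨5, polygon, weight, propagation, 0, ⟨_, mem_interior_face_floor_left⟩,
      not_isPreconnected_interior_face_floor⟩,
    ⟨5, polygon, weight, propagation, 3, ⟨_, mem_interior_face_ceiling⟩,
      disjoint_closure_interior_face_ceiling⟩⟩
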